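/- Let $Q$ be a finite-dimensional smooth manifold, let $N$ be an (injectively immersed, in particular possibly embedded) submanifold of $Q$ with inclusion $i_N\colon N\hookrightarrow Q$, put $i_{TN}=Ti_N\colon TN\to TQ$, and let $L\colon TN\to\mathbb R$ be a smooth regular Lagrangian, i.e. its fibre Hessian $\partial^2L/\partial\dot x^a\partial\dot x^b$ is nondegenerate at every point of $TN$. For a manifold $M$ let $\pi_M\colon T^*M\to M$ be the cotangent bundle and let $\alpha_M\colon TT^*M\to T^*TM$ be the Tulczyjew isomorphism, given in induced coordinates by $\alpha_M(q,p,\dot q,\dot p)=(q,\dot q,\dot p,p)$. Let $$\Sigma_L=\{\mu\in T^*_{i_{TN}(v)}TQ \;:\; v\in TN,\ (i_{TN})^*\mu={\rm d}L(v)\}\subset T^*TQ ,$$ let $T^*_NQ=\pi_Q^{-1}(N)\subset T^*Q$ (for an immersed $N$, the pullback of $T^*Q$ along $i_N$ with its canonical map to $T^*Q$), and let $i_N^*\colon T^*_NQ\to T^*N$ be the restriction of covectors to tangent vectors of $N$, with tangent map $Ti_N^*\colon T(T^*_NQ)\to TT^*N$. Then $$(\alpha_Q)^{-1}(\Sigma_L)=\left\{X\in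 T(T^*_NQ)\subset TT^*Q\;:\; Ti_N^*(X)\in(\alpha_N)^{-1}({\rm d}L(TN))\right\}.$$ -/

import Mathlib

open scoped Manifold ContDiff Bundle
open Bundle

noncomputable section

section General

variable {E : Type*} [NormedAddCommGroup E] [NormedSpace ℝ E] {H : Type*} [TopologicalSpace H]
  (I : ModelWithCorners ℝ E H) (M : Type*) [TopologicalSpace M] [ChartedSpace H M]

/-- The cotangent space `T*_q M`, the fibre at `q` of the bundle of continuous linear maps from the
tangent bundle to the trivial line bundle. -/
abbrev CotangentSpace (q : M) : Type _ := TangentSpace I q →L[ℝ] Trivial M ℝ q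

/-- The cotangent bundle `T*M`, with Mathlib's topology and manifold structure on a bundle of
continuous linear maps. For `μ : CotangentBundle I M`, `μ.proj` is the base point (so that
`TotalSpace.proj` is the projection `π_M`) and `μ.2` is the covector. -/
abbrev CotangentBundle [IsManifold I 1 M] : Type _ :=
  TotalSpace (E →L[ℝ] ℝ) (CotangentSpace I M)

/-- The model with corners of `T*M`: base coordinates and coordinates in the dual space `E*`. -/
abbrev cotangentModel : ModelWithCorners ℝ (E × (E →L[ℝ] ℝ)) (ModelProd H (E →L[ℝ] ℝ)) :=
  I.prod 𝓘(ℝ, E →L[ℝ] ℝ)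

variable {M}

/-- The Tulczyjew map `α_M : TT*M → T*TM`, given in induced coordinates by
`(q, p, q̇, ṗ) ↦ (q, q̇, ṗ, p)`.

The coordinates used at a point over `q` are those induced by the preferred chart `chartAt H q`.
In Mathlib the tangent space of a manifold at a point is the model vector space, a tangent vector
being identified with its coordinates in the preferred chart at that point, and the preferred chart
of `T*M` at `μ_q` (of `TM` at `v_q`) is the one induced by `chartAt H q`. So for
`X : TT*M` over `μ_q`, the components of `X.2` are `q̇` and `ṗ`, and those of `μ_q` are `μ_q.2`.
The value `(q, q̇, ṗ, p)` is the covector `(δq, δq̇) ↦ ṗ δq + p δq̇` at the point `(q, q̇)` of `TM`. -/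
def tulczyjew [IsManifold I 1 M] [IsManifold I.tangent 1 (TangentBundle I M)]
    (X : TangentBundle (cotangentModel I) (CotangentBundle I M)) :
    CotangentBundle I.tangent (TangentBundle I M) :=
  let q : M := X.proj.proj
  let p : E →L[ℝ] ℝ := X.proj.2
  let qdot : E := X.2.1
  let pdot : E →L[ℝ] ℝ := X.2.2
  ⟨(⟨q, qdot⟩ : TangentBundle I M),
    (pdot.comp (ContinuousLinearMap.fst ℝ E E) + p.comp (ContinuousLinearMap.snd ℝ E E) :
      E × E →L[ℝ] ℝ)⟩

/-- The image `df(M) ⊆ T*M` of the differential of a function `f : M → ℝ`. -/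
def imageDifferential [IsManifold I 1 M] (f : M → ℝ) : Set (CotangentBundle I M) :=
  Set.range fun q : M => (⟨q, mfderiv I 𝓘(ℝ, ℝ) f q⟩ : CotangentBundle I M)

/-- A smooth function `L : TM → ℝ` is a regular Lagrangian if at every `v ∈ T_q M` its fibre
Hessian `∂²L/∂q̇∂q̇`, the bilinear form `(u, w) ↦ ∂²/∂s∂t L(v + s u + t w)` at `s = t = 0` on
`T_q M`, is nondegenerate. -/
def IsRegularLagrangian [IsManifold I 1 M] (L : TangentBundle I M → ℝ) : Prop :=
  ContMDiff I.tangent 𝓘(ℝ, ℝ) ∞ L ∧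
    ∀ (q : M) (v u : TangentSpace I q),
      (∀ w : TangentSpace I q,
        deriv (fun s : ℝ => deriv (fun t : ℝ =>
          L (⟨q, v + s • u + t • w⟩ : TangentBundle I M)) 0) 0 = 0) → u = 0

end General

section Submanifold

variable {E : Type*} [NormedAddCommGroup E] [NormedSpace ℝ E]
  {F : Type*} [NormedAddCommGroup F] [NormedSpace ℝ F]
  {HQ : Type*} [TopologicalSpace HQ] {HN : Type*} [TopologicalSpace HN]
  {I : ModelWithCorners ℝ E HQ} {J : ModelWithCorners ℝ F HN}
  {Q : Type*} [TopologicalSpace Q] [ChartedSpace HQ Q] [IsManifold I 1 Q]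
  {N : Type*} [TopologicalSpace N] [ChartedSpace HN N] [IsManifold J 1 N]
  (ι : C^∞⟮J, N; I, Q⟯)

/-- The manifold `T*_N Q = π_Q⁻¹(N)` of covectors of `Q` at points of `N`: the pullback of the
cotangent bundle of `Q` along the inclusion `ι : N → Q`. -/
abbrev RestrictedCotangentBundle : Type _ :=
  TotalSpace (E →L[ℝ] ℝ) (ι *ᵖ (CotangentSpace I Q))

/-- The inclusion `T*_N Q → T*Q`. -/
def restrictedCotangentInclusion (ξ : RestrictedCotangentBundle ι) : CotangentBundle I Q :=
  ⟨ι ξ.proj, ξ.2⟩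

/-- The map `i_N^* : T*_N Q → T*N` restricting a covector at `x ∈ N` from `T_x Q` to `T_x N`. -/
def restrictCovector (ξ : RestrictedCotangentBundle ι) : CotangentBundle J N :=
  ⟨ξ.proj, (show CotangentSpace I Q (ι ξ.proj) from ξ.2).comp (mfderiv J I ι ξ.proj)⟩

/-- The set `Σ_L ⊆ T*TQ` of covectors `μ` at points `i_TN(v)`, `v ∈ TN`, with
`(i_TN)^* μ = dL(v)`, where `i_TN = T ι`. -/
def sigmaLagrangian [IsManifold I.tangent 1 (TangentBundle I Q)] (L : TangentBundle J N → ℝ) :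
    Set (CotangentBundle I.tangent (TangentBundle I Q)) :=
  {μ | ∃ (v : TangentBundle J N)
      (m : CotangentSpace I.tangent (TangentBundle I Q) (tangentMap J I ι v)),
    μ = ⟨tangentMap J I ι v, m⟩ ∧
      m.comp (mfderiv J.tangent I.tangent (tangentMap J I ι) v) =
        mfderiv J.tangent 𝓘(ℝ, ℝ) L v}

end Submanifold

end

open Filter
open scoped Topology

/-! In charts, let A be the derivative and D the second derivative of the local representative of
`ι`. A tangent vector Z = (x, p, ẋ, ṗ) of T*_N Q, included in TT*Q, is sent by α_Q to the covector
(δq, δq̇) ↦ ṗ δq + p δq̇ at Tι(x, ẋ), and every covector there arises in this way.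

The theorem rests on naturality (`tulczyjew_tangentMap_restrictCovector`): α_N(T i_N^*(Z)) is the
pullback of that covector by Tι. Restriction is (x, p) ↦ (x, p ∘ A(x)), so the former is p D(ẋ, δx)
+ ṗ A δx + p A δẋ. The tangent map is (x, ẋ) ↦ (ι x, A(x) ẋ), so the latter is ṗ A δx + p (A δẋ +
D(δx, ẋ)). They agree because D is symmetric.

Hence the condition defining Σ_L says that α_N(T i_N^*(Z)) = dL(x, ẋ), and injectivity of α_Q
identifies X with the image of Z. -/

theorem hasFDerivWithinAt_prod_iff_of_eventuallyEq
    {E F G : Type*} [NormedAddCommGroup E] [NormedSpace ℝ E] [NormedAddCommGroup F]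
    [NormedSpace ℝ F] [NormedAddCommGroup G] [NormedSpace ℝ G] {u : E → F × G} {a : E → F}
    {b : E → G} {s : Set E} {x : E} {u' : E →L[ℝ] F × G}
    (h : u =ᶠ[𝓝[s] x] fun y => (a y, b y)) (hx : x ∈ s) :
    HasFDerivWithinAt u u' s x ↔
      HasFDerivWithinAt a ((ContinuousLinearMap.fst ℝ F G).comp u') s x ∧
        HasFDerivWithinAt b ((ContinuousLinearMap.snd ℝ F G).comp u') s x := by
  rw [h.hasFDerivWithinAt_iff_of_mem hx]
  exact ⟨fun hu => ⟨hu.fst, hu.snd⟩, fun hab => hab.1.prodMk hab.2⟩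

/-! ### Derivatives of maps into fibre bundles -/

section FiberBundle

variable {EM : Type*} [NormedAddCommGroup EM] [NormedSpace ℝ EM] {HM : Type*} [TopologicalSpace HM]
  {IM : ModelWithCorners ℝ EM HM} {M : Type*} [TopologicalSpace M] [ChartedSpace HM M]
  {EB : Type*} [NormedAddCommGroup EB] [NormedSpace ℝ EB] {HB : Type*} [TopologicalSpace HB]
  {IB : ModelWithCorners ℝ EB HB} {B : Type*} [TopologicalSpace B] [ChartedSpace HB B]
  {F : Type*} [NormedAddCommGroup F] [NormedSpace ℝ F] {V : B → Type*}
  [TopologicalSpace (TotalSpace F V)] [∀ b, TopologicalSpace (V b)] [FiberBundle F V]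

/-- The derivative of a map into a fiber bundle is computed separately on the base and in the
preferred trivialization. -/
theorem hasMFDerivAt_totalSpace {f : M → TotalSpace F V} {x : M} {f' : EM →L[ℝ] EB × F} :
    HasMFDerivAt IM (IB.prod 𝓘(ℝ, F)) f x f' ↔
      HasMFDerivAt IM IB (fun y => (f y).proj) x ((ContinuousLinearMap.fst ℝ EB F).comp f') ∧
        HasMFDerivAt IM 𝓘(ℝ, F) (fun y => (trivializationAt F V (f x).proj (f y)).2) x
          ((ContinuousLinearMap.snd ℝ EB F).comp f') := by
  simp only [HasMFDerivAt]
  rw [and_and_and_comm, ← FiberBundle.continuousAt_totalSpace, and_congr_right_iff]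
  intro hf
  -- The bundle chart splits as a product only over the base set of the trivialization, where `f`
  -- stays near `x` by continuity.
  have h1 : ∀ᶠ y in 𝓝[Set.range IM] (extChartAt IM x x),
      (f ((extChartAt IM x).symm y)).proj ∈ (trivializationAt F V (f x).proj).baseSet := by
    have h2 : ContinuousAt (fun y => (f y).proj) x :=
      (FiberBundle.continuous_proj F V).continuousAt.comp hf
    have h3 : ContinuousAt (extChartAt IM x).symm (extChartAt IM x x) :=
      continuousAt_extChartAt_symm x
    have h4 := h3.tendsto
    rw [extChartAt_to_inv] at h4
    exact nhdsWithin_le_nhds ((h2.tendsto.comp h4).eventually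
      ((trivializationAt F V (f x).proj).open_baseSet.mem_nhds
        (mem_baseSet_trivializationAt F V (f x).proj)))
  have h2 : writtenInExtChartAt IM (IB.prod 𝓘(ℝ, F)) x f =ᶠ[𝓝[Set.range IM] (extChartAt IM x x)]
      fun y => (writtenInExtChartAt IM IB x (fun y => (f y).proj) y,
        writtenInExtChartAt IM 𝓘(ℝ, F) x
          (fun y => (trivializationAt F V (f x).proj (f y)).2) y) := by
    filter_upwards [h1] with y hy
    simp only [writtenInExtChartAt, FiberBundle.extChartAt, Function.comp_apply,
      PartialEquiv.trans_apply, PartialEquiv.prod_coe, PartialEquiv.refl_coe, id,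
      OpenPartialHomeomorph.coe_toPartialEquiv, Trivialization.coe_coe, extChartAt_model_space_eq_id]
    rw [Trivialization.coe_fst' _ hy]
  have hx : extChartAt IM x x ∈ Set.range IM := by simp
  exact hasFDerivWithinAt_prod_iff_of_eventuallyEq h2 hx

theorem hasMFDerivAt_proj (ξ : TotalSpace F V) :
    HasMFDerivAt (IB.prod 𝓘(ℝ, F)) IB (fun η : TotalSpace F V => η.proj) ξ
      (ContinuousLinearMap.fst ℝ EB F) :=
  (hasMFDerivAt_totalSpace.1 (hasMFDerivAt_id ξ)).1

theorem hasMFDerivAt_trivializationAt_snd (ξ : TotalSpace F V) :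
    HasMFDerivAt (IB.prod 𝓘(ℝ, F)) 𝓘(ℝ, F)
      (fun η : TotalSpace F V => (trivializationAt F V ξ.proj η).2) ξ
      (ContinuousLinearMap.snd ℝ EB F) :=
  (hasMFDerivAt_totalSpace.1 (hasMFDerivAt_id ξ)).2

end FiberBundle

/-! ### The differential of `ι` in charts, and its derivative -/

section InTangentCoordinates

variable {E : Type*} [NormedAddCommGroup E] [NormedSpace ℝ E]
  {F : Type*} [NormedAddCommGroup F] [NormedSpace ℝ F]
  {Q : Type*} [TopologicalSpace Q] [ChartedSpace E Q] [IsManifold 𝓘(ℝ, E) ∞ Q]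
  {N : Type*} [TopologicalSpace N] [ChartedSpace F N] [IsManifold 𝓘(ℝ, F) ∞ N]
  {ι : N → Q} {x : N}

omit [NormedSpace ℝ E] [NormedSpace ℝ F] [IsManifold 𝓘(ℝ, E) ∞ Q] [IsManifold 𝓘(ℝ, F) ∞ N] in
theorem eventually_mem_chart_source (hι : ContinuousAt ι x) :
    ∀ᶠ y in 𝓝 x, y ∈ (chartAt F x).source ∧ ι y ∈ (chartAt E (ι x)).source :=
  Filter.Eventually.and ((chartAt F x).open_source.mem_nhds (mem_chart_source F x))
    (hι.eventually ((chartAt E (ι x)).open_source.mem_nhds (mem_chart_source E (ι x))))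

/-- At the centre of the charts both coordinate changes are from a preferred chart to itself, hence
the identity. -/
theorem inTangentCoordinates_mfderiv_self :
    inTangentCoordinates 𝓘(ℝ, F) 𝓘(ℝ, E) id ι (mfderiv 𝓘(ℝ, F) 𝓘(ℝ, E) ι) x x =
      mfderiv 𝓘(ℝ, F) 𝓘(ℝ, E) ι x := by
  rw [inTangentCoordinates_eq id ι (mfderiv 𝓘(ℝ, F) 𝓘(ℝ, E) ι) (mem_chart_source F x)
    (mem_chart_source E (ι x))]
  ext v
  exact ((tangentBundleCore 𝓘(ℝ, E) Q).coordChange_self (achart E (ι x)) (ι x)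
    (mem_chart_source E (ι x)) _).trans (congrArg (mfderiv 𝓘(ℝ, F) 𝓘(ℝ, E) ι x)
      ((tangentBundleCore 𝓘(ℝ, F) N).coordChange_self (achart F x) x (mem_chart_source F x) v))

/-- The differential of `ι`, in the charts at `x` and `ι x`, is the derivative of the local
representative of `ι`. -/
theorem inTangentCoordinates_mfderiv_eventuallyEq (hι : ContMDiff 𝓘(ℝ, F) 𝓘(ℝ, E) ∞ ι) :
    ∀ᶠ y in 𝓝 (extChartAt 𝓘(ℝ, F) x x),
      inTangentCoordinates 𝓘(ℝ, F) 𝓘(ℝ, E) id ι (mfderiv 𝓘(ℝ, F) 𝓘(ℝ, E) ι) x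
          ((extChartAt 𝓘(ℝ, F) x).symm y) =
        fderiv ℝ (writtenInExtChartAt 𝓘(ℝ, F) 𝓘(ℝ, E) x ι) y := by
  have h1 := (continuousAt_extChartAt_symm (I := 𝓘(ℝ, F)) x).tendsto
  rw [extChartAt_to_inv] at h1
  filter_upwards [h1.eventually (eventually_mem_chart_source (E := E) (F := F) hι.continuous.continuousAt),
    extChartAt_target_mem_nhds (I := 𝓘(ℝ, F)) x] with y hy hy'
  set z := (extChartAt 𝓘(ℝ, F) x).symm y with hz
  have hzy : extChartAt 𝓘(ℝ, F) x z = y := (extChartAt 𝓘(ℝ, F) x).right_inv hy'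
  rw [inTangentCoordinates_eq_mfderiv_comp (x₀ := x) (x := z) (f := id) (g := ι) hy.1 hy.2]
  have e1 : HasMFDerivAt 𝓘(ℝ, F) 𝓘(ℝ, F) (extChartAt 𝓘(ℝ, F) x).symm y
      (mfderivWithin 𝓘(ℝ, F) 𝓘(ℝ, F) (extChartAt 𝓘(ℝ, F) x).symm Set.univ y) := by
    rw [mfderivWithin_univ]
    have := mdifferentiableWithinAt_extChartAt_symm (I := 𝓘(ℝ, F)) hy'
    simp only [modelWithCornersSelf_coe, Set.range_id, mdifferentiableWithinAt_univ] at this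
    exact this.hasMFDerivAt
  have e2 : HasMFDerivAt 𝓘(ℝ, F) 𝓘(ℝ, E) ι z (mfderiv 𝓘(ℝ, F) 𝓘(ℝ, E) ι z) :=
    (hι.mdifferentiable (by simp) z).hasMFDerivAt
  have e3 : HasMFDerivAt 𝓘(ℝ, E) 𝓘(ℝ, E) (extChartAt 𝓘(ℝ, E) (ι x)) (ι z)
      (mfderiv 𝓘(ℝ, E) 𝓘(ℝ, E) (extChartAt 𝓘(ℝ, E) (ι x)) (ι z)) :=
    (mdifferentiableAt_extChartAt hy.2).hasMFDerivAt
  have e4 := HasMFDerivAt.comp y e3 (HasMFDerivAt.comp y e2 e1)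
  simp only [id, modelWithCornersSelf_coe, Set.range_id]
  rw [hzy]
  have key : ∀ A : F →L[ℝ] E, HasMFDerivAt 𝓘(ℝ, F) 𝓘(ℝ, E)
      (writtenInExtChartAt 𝓘(ℝ, F) 𝓘(ℝ, E) x ι) y A →
      A = fderiv ℝ (writtenInExtChartAt 𝓘(ℝ, F) 𝓘(ℝ, E) x ι) y :=
    fun A hA => by
      have h : HasFDerivAt (writtenInExtChartAt 𝓘(ℝ, F) 𝓘(ℝ, E) x ι) A y :=
        hasMFDerivAt_iff_hasFDerivAt.1 hA
      exact h.fderiv.symm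
  exact key _ e4

/-- D is the second Fréchet derivative of the local representative, so its symmetry is Schwarz's
theorem. -/
theorem exists_hasMFDerivAt_inTangentCoordinates (hι : ContMDiff 𝓘(ℝ, F) 𝓘(ℝ, E) ∞ ι) (x : N) :
    ∃ D : F →L[ℝ] F →L[ℝ] E, (∀ u v, D u v = D v u) ∧
      HasMFDerivAt 𝓘(ℝ, F) 𝓘(ℝ, F →L[ℝ] E)
        (inTangentCoordinates 𝓘(ℝ, F) 𝓘(ℝ, E) id ι (mfderiv 𝓘(ℝ, F) 𝓘(ℝ, E) ι) x) x D := by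
  set f := writtenInExtChartAt 𝓘(ℝ, F) 𝓘(ℝ, E) x ι
  have hf : ContDiffAt ℝ ∞ f (extChartAt 𝓘(ℝ, F) x x) := by
    have := (contMDiffAt_iff.1 (hι x)).2
    rwa [modelWithCornersSelf_coe, Set.range_id, contDiffWithinAt_univ] at this
  have hsymm : IsSymmSndFDerivAt ℝ f (extChartAt 𝓘(ℝ, F) x x) :=
    hf.isSymmSndFDerivAt (by simp; exact WithTop.coe_le_coe.2 le_top)
  refine ⟨fderiv ℝ (fderiv ℝ f) (extChartAt 𝓘(ℝ, F) x x), fun u v => hsymm u v, ?_⟩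
  have hT := ContMDiffAt.mfderiv_const (m := 1) (hι x) (by norm_cast)
  refine ⟨hT.continuousAt, ?_⟩
  have h1 : HasFDerivAt (fderiv ℝ f) (fderiv ℝ (fderiv ℝ f) (extChartAt 𝓘(ℝ, F) x x))
      (extChartAt 𝓘(ℝ, F) x x) :=
    ((hf.fderiv_right (m := 1) (by norm_cast)).differentiableAt (by simp)).hasFDerivAt
  exact (h1.congr_of_eventuallyEq (inTangentCoordinates_mfderiv_eventuallyEq hι)).hasFDerivWithinAt

end InTangentCoordinates

/-! ### Derivatives of the restriction of covectors and of the tangent map -/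

section Prolongation

variable {E : Type*} [NormedAddCommGroup E] [NormedSpace ℝ E]
  {F : Type*} [NormedAddCommGroup F] [NormedSpace ℝ F]
  {Q : Type*} [TopologicalSpace Q] [ChartedSpace E Q] [IsManifold 𝓘(ℝ, E) ∞ Q]
  {N : Type*} [TopologicalSpace N] [ChartedSpace F N] [IsManifold 𝓘(ℝ, F) ∞ N]

theorem trivializationAt_tangentMap_snd {ι : N → Q} {x : N} {v : TangentBundle 𝓘(ℝ, F) N}
    (h : v.proj ∈ (chartAt F x).source) (h' : ι v.proj ∈ (chartAt E (ι x)).source) :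
    (trivializationAt E (TangentSpace 𝓘(ℝ, E)) (ι x) (tangentMap 𝓘(ℝ, F) 𝓘(ℝ, E) ι v)).2 =
      inTangentCoordinates 𝓘(ℝ, F) 𝓘(ℝ, E) id ι (mfderiv 𝓘(ℝ, F) 𝓘(ℝ, E) ι) x v.proj
        (trivializationAt F (TangentSpace 𝓘(ℝ, F)) x v).2 := by
  have h1 : v.proj ∈ (trivializationAt F (TangentSpace 𝓘(ℝ, F)) x).baseSet := h
  have h2 : ι v.proj ∈ (trivializationAt E (TangentSpace 𝓘(ℝ, E)) (ι x)).baseSet := h'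
  have h3 := (trivializationAt F (TangentSpace 𝓘(ℝ, F)) x).symmL_continuousLinearMapAt
    (R := ℝ) h1 v.2
  have h4 : (trivializationAt F (TangentSpace 𝓘(ℝ, F)) x).continuousLinearMapAt ℝ v.proj v.2 =
      (trivializationAt F (TangentSpace 𝓘(ℝ, F)) x v).2 :=
    congrFun ((trivializationAt F (TangentSpace 𝓘(ℝ, F)) x).coe_linearMapAt_of_mem (R := ℝ) h1) v.2
  have h5 : ∀ w : TangentSpace 𝓘(ℝ, E) (ι v.proj),
      (trivializationAt E (TangentSpace 𝓘(ℝ, E)) (ι x)).continuousLinearMapAt ℝ (ι v.proj) w =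
      (trivializationAt E (TangentSpace 𝓘(ℝ, E)) (ι x) ⟨ι v.proj, w⟩).2 :=
    congrFun ((trivializationAt E (TangentSpace 𝓘(ℝ, E)) (ι x)).coe_linearMapAt_of_mem (R := ℝ) h2)
  rw [h4] at h3
  exact (h5 _).symm.trans (congrArg (fun w => (trivializationAt E (TangentSpace 𝓘(ℝ, E))
    (ι x)).continuousLinearMapAt ℝ (ι v.proj) (mfderiv 𝓘(ℝ, F) 𝓘(ℝ, E) ι v.proj w)) h3.symm)

/-- Covectors are trivialized by precomposition with the inverse tangent trivialization; inserting
that inverse and the trivialization itself at `ι ξ.proj` splits off the factor A. -/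
theorem trivializationAt_restrictCovector_snd (ι : C^∞⟮𝓘(ℝ, F), N; 𝓘(ℝ, E), Q⟯) {x : N}
    {ξ : RestrictedCotangentBundle ι} (h' : ι ξ.proj ∈ (chartAt E (ι x)).source) :
    (trivializationAt (F →L[ℝ] ℝ) (CotangentSpace 𝓘(ℝ, F) N) x (restrictCovector ι ξ)).2 =
      ((trivializationAt (E →L[ℝ] ℝ) (ι *ᵖ (CotangentSpace 𝓘(ℝ, E) Q)) x ξ).2 : E →L[ℝ] ℝ).comp
        (inTangentCoordinates 𝓘(ℝ, F) 𝓘(ℝ, E) id ι (mfderiv 𝓘(ℝ, F) 𝓘(ℝ, E) ι) x ξ.proj) := by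
  have h2 : ι ξ.proj ∈ (trivializationAt E (TangentSpace 𝓘(ℝ, E)) (ι x)).baseSet := h'
  have h3 := (trivializationAt E (TangentSpace 𝓘(ℝ, E)) (ι x)).symmL_continuousLinearMapAt
    (R := ℝ) h2
  ext u
  exact (congrArg (fun w => (trivializationAt ℝ (Trivial N ℝ) x).continuousLinearMapAt ℝ ξ.proj
    ((show CotangentSpace 𝓘(ℝ, E) Q (ι ξ.proj) from ξ.2) w)) (h3 _)).symm

theorem trivializationAt_tangentBundle_self (v : TangentBundle 𝓘(ℝ, F) N) :
    (trivializationAt F (TangentSpace 𝓘(ℝ, F)) v.proj v).2 = v.2 :=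
  (tangentBundleCore 𝓘(ℝ, F) N).coordChange_self (achart F v.proj) v.proj
    (mem_chart_source F v.proj) v.2

omit [IsManifold 𝓘(ℝ, F) ∞ N] in
theorem trivializationAt_restrictedCotangentBundle_self (ι : C^∞⟮𝓘(ℝ, F), N; 𝓘(ℝ, E), Q⟯)
    (ξ : RestrictedCotangentBundle ι) :
    (trivializationAt (E →L[ℝ] ℝ) (ι *ᵖ (CotangentSpace 𝓘(ℝ, E) Q)) ξ.proj ξ).2 = ξ.2 := by
  refine ContinuousLinearMap.ext fun u => ?_
  have h := DFunLike.congr_fun (TangentBundle.symmL_trivializationAt_eq_core (I := 𝓘(ℝ, E))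
    (mem_chart_source E (ι ξ.proj))) u
  have h' := h.trans ((tangentBundleCore 𝓘(ℝ, E) Q).coordChange_self (achart E (ι ξ.proj))
    (ι ξ.proj) (mem_chart_source E (ι ξ.proj)) u)
  have h0 : ∀ r : ℝ, (trivializationAt ℝ (Trivial Q ℝ) (ι ξ.proj)).continuousLinearMapAt ℝ
      (ι ξ.proj) r = r := fun r =>
    DFunLike.congr_fun (Bundle.Trivial.continuousLinearMapAt_trivialization ℝ Q ℝ (ι ξ.proj)) r
  exact (congrArg (fun w => (trivializationAt ℝ (Trivial Q ℝ) (ι ξ.proj)).continuousLinearMapAt ℝ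
    (ι ξ.proj) ((show CotangentSpace 𝓘(ℝ, E) Q (ι ξ.proj) from ξ.2) w)) h').trans (h0 _)

variable (ι : C^∞⟮𝓘(ℝ, F), N; 𝓘(ℝ, E), Q⟯)

omit [IsManifold 𝓘(ℝ, F) ∞ N] in
theorem hasMFDerivAt_comp_proj {G : Type*} [NormedAddCommGroup G] [NormedSpace ℝ G]
    {V : N → Type*} [TopologicalSpace (TotalSpace G V)] [∀ x, TopologicalSpace (V x)]
    [FiberBundle G V] {P : Type*} [NormedAddCommGroup P] [NormedSpace ℝ P]
    {H : Type*} [TopologicalSpace H] {I : ModelWithCorners ℝ P H} {M : Type*} [TopologicalSpace M]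
    [ChartedSpace H M] {f : N → M} {ξ : TotalSpace G V} {A : F →L[ℝ] P}
    (hA : HasMFDerivAt 𝓘(ℝ, F) I f ξ.proj A) :
    HasMFDerivAt (𝓘(ℝ, F).prod 𝓘(ℝ, G)) I (fun η : TotalSpace G V => f η.proj) ξ
      (A.comp (ContinuousLinearMap.fst ℝ F G)) :=
  HasMFDerivAt.comp ξ hA (hasMFDerivAt_proj (IB := 𝓘(ℝ, F)) ξ)

omit [IsManifold 𝓘(ℝ, F) ∞ N] in
-- The pullback bundle carries the trivializations of T*Q, so the inclusion is the identity on fibre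
-- coordinates.
theorem hasMFDerivAt_restrictedCotangentInclusion {ξ : RestrictedCotangentBundle ι}
    {A : F →L[ℝ] E} (hA : HasMFDerivAt 𝓘(ℝ, F) 𝓘(ℝ, E) ι ξ.proj A) :
    HasMFDerivAt (𝓘(ℝ, F).prod 𝓘(ℝ, E →L[ℝ] ℝ)) (cotangentModel 𝓘(ℝ, E))
      (restrictedCotangentInclusion ι) ξ
      (A.prodMap (ContinuousLinearMap.id ℝ (E →L[ℝ] ℝ))) :=
  hasMFDerivAt_totalSpace.2 ⟨hasMFDerivAt_comp_proj hA,
    hasMFDerivAt_trivializationAt_snd (IB := 𝓘(ℝ, F)) ξ⟩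

section CLM

variable {EM : Type*} [NormedAddCommGroup EM] [NormedSpace ℝ EM] {HM : Type*} [TopologicalSpace HM]
  {IM : ModelWithCorners ℝ EM HM} {M : Type*} [TopologicalSpace M] [ChartedSpace HM M]
  {V₁ V₂ V₃ : Type*} [NormedAddCommGroup V₁] [NormedSpace ℝ V₁] [NormedAddCommGroup V₂]
  [NormedSpace ℝ V₂] [NormedAddCommGroup V₃] [NormedSpace ℝ V₃] {x : M}

theorem HasMFDerivAt.clm_comp_modelSpace {c : M → V₂ →L[ℝ] V₃} {d : M → V₁ →L[ℝ] V₂}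
    {c' : EM →L[ℝ] V₂ →L[ℝ] V₃} {d' : EM →L[ℝ] V₁ →L[ℝ] V₂}
    (hc : HasMFDerivAt IM 𝓘(ℝ, V₂ →L[ℝ] V₃) c x c')
    (hd : HasMFDerivAt IM 𝓘(ℝ, V₁ →L[ℝ] V₂) d x d') :
    HasMFDerivAt IM 𝓘(ℝ, V₁ →L[ℝ] V₃) (fun y => (c y).comp (d y)) x
      ((ContinuousLinearMap.compL ℝ V₁ V₂ V₃ (c x)).comp d' +
        ((ContinuousLinearMap.compL ℝ V₁ V₂ V₃).flip (d x)).comp c') := by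
  refine ⟨hc.1.clm_comp hd.1, ?_⟩
  have h := HasFDerivWithinAt.clm_comp hc.2 hd.2
  simpa only [writtenInExtChartAt, Function.comp_apply, extChartAt_to_inv,
    extChartAt_model_space_eq_id, PartialEquiv.refl_coe, id] using! h

theorem HasMFDerivAt.clm_apply_modelSpace {c : M → V₁ →L[ℝ] V₂} {d : M → V₁}
    {c' : EM →L[ℝ] V₁ →L[ℝ] V₂} {d' : EM →L[ℝ] V₁}
    (hc : HasMFDerivAt IM 𝓘(ℝ, V₁ →L[ℝ] V₂) c x c')
    (hd : HasMFDerivAt IM 𝓘(ℝ, V₁) d x d') :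
    HasMFDerivAt IM 𝓘(ℝ, V₂) (fun y => c y (d y)) x ((c x).comp d' + c'.flip (d x)) := by
  refine ⟨hc.1.clm_apply hd.1, ?_⟩
  have h := HasFDerivWithinAt.clm_apply hc.2 hd.2
  simpa only [writtenInExtChartAt, Function.comp_apply, extChartAt_to_inv,
    extChartAt_model_space_eq_id, PartialEquiv.refl_coe, id] using! h

end CLM

/-- The second derivative `D` of the local representative of `ι` in the charts at `x` and `ι x`
gives the derivatives of both the restriction of covectors and the tangent map of `ι`. -/
theorem exists_hasMFDerivAt_restrictCovector_tangentMap {x : N} {A : F →L[ℝ] E}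
    (hA : HasMFDerivAt 𝓘(ℝ, F) 𝓘(ℝ, E) ι x A) :
    ∃ D : F →L[ℝ] F →L[ℝ] E, (∀ u v, D u v = D v u) ∧
      (∀ p : E →L[ℝ] ℝ,
        HasMFDerivAt (𝓘(ℝ, F).prod 𝓘(ℝ, E →L[ℝ] ℝ)) (cotangentModel 𝓘(ℝ, F)) (restrictCovector ι)
          (⟨x, p⟩ : RestrictedCotangentBundle ι)
          ((ContinuousLinearMap.fst ℝ F (E →L[ℝ] ℝ)).prod
            ((ContinuousLinearMap.compL ℝ F E ℝ p).comp
                (D.comp (ContinuousLinearMap.fst ℝ F (E →L[ℝ] ℝ))) +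
              ((ContinuousLinearMap.compL ℝ F E ℝ).flip A).comp
                (ContinuousLinearMap.snd ℝ F (E →L[ℝ] ℝ))))) ∧
      (∀ v : F,
        HasMFDerivAt 𝓘(ℝ, F).tangent 𝓘(ℝ, E).tangent (tangentMap 𝓘(ℝ, F) 𝓘(ℝ, E) ι)
          (⟨x, v⟩ : TangentBundle 𝓘(ℝ, F) N)
          ((A.comp (ContinuousLinearMap.fst ℝ F F)).prod
            (A.comp (ContinuousLinearMap.snd ℝ F F) +
              (D.comp (ContinuousLinearMap.fst ℝ F F)).flip v))) := by
  obtain ⟨D, hD, hT⟩ := exists_hasMFDerivAt_inTangentCoordinates ι.contMDiff x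
  have hself : inTangentCoordinates 𝓘(ℝ, F) 𝓘(ℝ, E) id ι (mfderiv 𝓘(ℝ, F) 𝓘(ℝ, E) ι) x x = A :=
    inTangentCoordinates_mfderiv_self.trans hA.mfderiv
  have hev := eventually_mem_chart_source (E := E) (F := F) (x := x) ι.contMDiff.continuous.continuousAt
  refine ⟨D, hD, fun p => hasMFDerivAt_totalSpace.2 ⟨?_, ?_⟩,
    fun v => hasMFDerivAt_totalSpace.2 ⟨?_, ?_⟩⟩
  · exact hasMFDerivAt_proj (IB := 𝓘(ℝ, F)) _
  · set ξ : RestrictedCotangentBundle ι := ⟨x, p⟩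
    have h := HasMFDerivAt.clm_comp_modelSpace
      (hasMFDerivAt_trivializationAt_snd (IB := 𝓘(ℝ, F)) ξ) (hasMFDerivAt_comp_proj (ξ := ξ) hT)
    rw [trivializationAt_restrictedCotangentBundle_self, hself] at h
    refine HasMFDerivAt.congr_of_eventuallyEq h ?_
    filter_upwards [(FiberBundle.continuous_proj (E →L[ℝ] ℝ)
      (ι *ᵖ (CotangentSpace 𝓘(ℝ, E) Q))).continuousAt.eventually hev] with η hη
    exact trivializationAt_restrictCovector_snd ι hη.2
  · exact hasMFDerivAt_comp_proj (ξ := (⟨x, v⟩ : TangentBundle 𝓘(ℝ, F) N)) hA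
  · set ξ : TangentBundle 𝓘(ℝ, F) N := ⟨x, v⟩
    have h := HasMFDerivAt.clm_apply_modelSpace (hasMFDerivAt_comp_proj (ξ := ξ) hT)
      (hasMFDerivAt_trivializationAt_snd (IB := 𝓘(ℝ, F)) ξ)
    rw [trivializationAt_tangentBundle_self, hself] at h
    refine HasMFDerivAt.congr_of_eventuallyEq h ?_
    filter_upwards [(FiberBundle.continuous_proj F
      (TangentSpace 𝓘(ℝ, F) : N → Type _)).continuousAt.eventually hev] with η hη
    exact trivializationAt_tangentMap_snd hη.1 hη.2

end Prolongation

/-! ### The Tulczyjew map and its naturality -/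

section Tulczyjew

variable {E : Type*} [NormedAddCommGroup E] [NormedSpace ℝ E]
  {F : Type*} [NormedAddCommGroup F] [NormedSpace ℝ F]
  {Q : Type*} [TopologicalSpace Q] [ChartedSpace E Q] [IsManifold 𝓘(ℝ, E) ∞ Q]
  {N : Type*} [TopologicalSpace N] [ChartedSpace F N] [IsManifold 𝓘(ℝ, F) ∞ N]

/-- The covector `(δq, δq̇) ↦ ṗ δq + p δq̇`. -/
def tulczyjewCovector (p pdot : E →L[ℝ] ℝ) : E × E →L[ℝ] ℝ :=
  pdot.comp (ContinuousLinearMap.fst ℝ E E) + p.comp (ContinuousLinearMap.snd ℝ E E)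

theorem tulczyjewCovector_inj {p pdot p' pdot' : E →L[ℝ] ℝ} :
    tulczyjewCovector p pdot = tulczyjewCovector p' pdot' ↔ p = p' ∧ pdot = pdot' := by
  refine ⟨fun h => ⟨?_, ?_⟩, fun h => by rw [h.1, h.2]⟩
  · ext u
    simpa [tulczyjewCovector] using DFunLike.congr_fun h ((0, u) : E × E)
  · ext u
    simpa [tulczyjewCovector] using DFunLike.congr_fun h ((u, 0) : E × E)

theorem tulczyjew_injective :
    Function.Injective (tulczyjew 𝓘(ℝ, E) (M := Q)) := by
  rintro ⟨⟨q, p⟩, ⟨qdot, pdot⟩⟩ ⟨⟨q', p'⟩, ⟨qdot', pdot'⟩⟩ h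
  obtain ⟨h1, h2⟩ := TotalSpace.mk.inj h
  obtain ⟨h3, h4⟩ := TotalSpace.mk.inj h1
  subst h3
  obtain rfl := eq_of_heq h4
  obtain ⟨rfl, rfl⟩ := tulczyjewCovector_inj.1 (eq_of_heq h2)
  rfl

variable (ι : C^∞⟮𝓘(ℝ, F), N; 𝓘(ℝ, E), Q⟯) (x : N) (v : F) (p pdot : E →L[ℝ] ℝ)

/-- The tangent vector of `T*_N Q` with components `(x, p, ẋ, ṗ)`. -/
def restrictedCotangentVector :
    TangentBundle (𝓘(ℝ, F).prod 𝓘(ℝ, E →L[ℝ] ℝ)) (RestrictedCotangentBundle ι) :=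
  ⟨⟨x, p⟩, ((v, pdot) : F × (E →L[ℝ] ℝ))⟩

omit [IsManifold 𝓘(ℝ, F) ∞ N] in
theorem tulczyjew_tangentMap_restrictedCotangentInclusion :
    tulczyjew 𝓘(ℝ, E) (tangentMap (𝓘(ℝ, F).prod 𝓘(ℝ, E →L[ℝ] ℝ)) (cotangentModel 𝓘(ℝ, E))
        (restrictedCotangentInclusion ι) (restrictedCotangentVector ι x v p pdot)) =
      ⟨tangentMap 𝓘(ℝ, F) 𝓘(ℝ, E) ι (⟨x, v⟩ : TangentBundle 𝓘(ℝ, F) N),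
        tulczyjewCovector p pdot⟩ := by
  have h := HasMFDerivAt.mfderiv (hasMFDerivAt_restrictedCotangentInclusion ι
    (ξ := ⟨x, p⟩) (ι.mdifferentiable x).hasMFDerivAt)
  have h' := DFunLike.congr_fun h ((v, pdot) : F × (E →L[ℝ] ℝ))
  exact congrArg (fun w : E × (E →L[ℝ] ℝ) => tulczyjew 𝓘(ℝ, E)
    (⟨⟨ι x, p⟩, w⟩ : TangentBundle (cotangentModel 𝓘(ℝ, E)) (CotangentBundle 𝓘(ℝ, E) Q))) h'

/-- Naturality of the Tulczyjew isomorphism: `α_N ∘ T i_N^*` is the pullback by `T ι` of `α_Q`. -/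
theorem tulczyjew_tangentMap_restrictCovector :
    tulczyjew 𝓘(ℝ, F) (tangentMap (𝓘(ℝ, F).prod 𝓘(ℝ, E →L[ℝ] ℝ)) (cotangentModel 𝓘(ℝ, F))
        (restrictCovector ι) (restrictedCotangentVector ι x v p pdot)) =
      ⟨(⟨x, v⟩ : TangentBundle 𝓘(ℝ, F) N),
        (show CotangentSpace 𝓘(ℝ, E).tangent (TangentBundle 𝓘(ℝ, E) Q)
            (tangentMap 𝓘(ℝ, F) 𝓘(ℝ, E) ι (⟨x, v⟩ : TangentBundle 𝓘(ℝ, F) N)) from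
          tulczyjewCovector p pdot).comp
          (mfderiv 𝓘(ℝ, F).tangent 𝓘(ℝ, E).tangent (tangentMap 𝓘(ℝ, F) 𝓘(ℝ, E) ι)
            (⟨x, v⟩ : TangentBundle 𝓘(ℝ, F) N))⟩ := by
  obtain ⟨A, hA⟩ : ∃ A : F →L[ℝ] E, HasMFDerivAt 𝓘(ℝ, F) 𝓘(ℝ, E) ι x A :=
    ⟨_, (ι.mdifferentiable x).hasMFDerivAt⟩
  obtain ⟨D, hD, hR, hT⟩ := exists_hasMFDerivAt_restrictCovector_tangentMap ι hA
  have hR' := DFunLike.congr_fun (HasMFDerivAt.mfderiv (hR p)) ((v, pdot) : F × (E →L[ℝ] ℝ))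
  rw [HasMFDerivAt.mfderiv (hT v)]
  refine (congrArg (fun w : F × (F →L[ℝ] ℝ) => tulczyjew 𝓘(ℝ, F)
    (⟨restrictCovector ι ⟨x, p⟩, w⟩ :
      TangentBundle (cotangentModel 𝓘(ℝ, F)) (CotangentBundle 𝓘(ℝ, F) N))) hR').trans ?_
  refine congrArg (TotalSpace.mk _) ?_
  have hA' : ∀ u : F, (mfderiv 𝓘(ℝ, F) 𝓘(ℝ, E) ι x : F → E) u = A u :=
    fun u => DFunLike.congr_fun hA.mfderiv u
  refine ContinuousLinearMap.ext fun w : F × F => ?_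
  -- Evaluated on w = (δx, δẋ), the two sides differ only in the order of the arguments of D.
  change p (D v w.1) + pdot (A w.1) + p ((mfderiv 𝓘(ℝ, F) 𝓘(ℝ, E) ι x : F → E) w.2) =
    pdot (A w.1) + p (A w.2 + D w.1 v)
  rw [hA', hD, map_add]
  ring

end Tulczyjew

theorem mainTheorem3
    {E : Type*} [NormedAddCommGroup E] [NormedSpace ℝ E] [FiniteDimensional ℝ E]
    {F : Type*} [NormedAddCommGroup F] [NormedSpace ℝ F] [FiniteDimensional ℝ F]
    {Q : Type*} [TopologicalSpace Q] [ChartedSpace E Q] [IsManifold 𝓘(ℝ, E) ∞ Q]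
    {N : Type*} [TopologicalSpace N] [ChartedSpace F N] [IsManifold 𝓘(ℝ, F) ∞ N]
    (ι : C^∞⟮𝓘(ℝ, F), N; 𝓘(ℝ, E), Q⟯)
    (hι : Manifold.IsImmersion 𝓘(ℝ, F) 𝓘(ℝ, E) ∞ ι) (hinj : Function.Injective ι)
    (L : TangentBundle 𝓘(ℝ, F) N → ℝ) (hL : IsRegularLagrangian 𝓘(ℝ, F) L) :
    tulczyjew 𝓘(ℝ, E) ⁻¹' sigmaLagrangian ι L =
      {X : TangentBundle (cotangentModel 𝓘(ℝ, E)) (CotangentBundle 𝓘(ℝ, E) Q) |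
        ∃ Z : TangentBundle (𝓘(ℝ, F).prod 𝓘(ℝ, E →L[ℝ] ℝ)) (RestrictedCotangentBundle ι),
          tangentMap (𝓘(ℝ, F).prod 𝓘(ℝ, E →L[ℝ] ℝ)) (cotangentModel 𝓘(ℝ, E))
              (restrictedCotangentInclusion ι) Z = X ∧
            tangentMap (𝓘(ℝ, F).prod 𝓘(ℝ, E →L[ℝ] ℝ)) (cotangentModel 𝓘(ℝ, F))
                (restrictCovector ι) Z ∈
              tulczyjew 𝓘(ℝ, F) ⁻¹' imageDifferential 𝓘(ℝ, F).tangent L} := by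
  ext X
  constructor
  · rintro ⟨⟨x, v⟩, m, h1, h2⟩
    obtain ⟨⟨q, p⟩, ⟨qdot, pdot⟩⟩ := X
    -- All fibres of T*TQ are the same model space, so heterogeneous equality over different base
    -- points is plain equality.
    obtain rfl : tulczyjewCovector (E := E) p pdot = m := eq_of_heq (TotalSpace.mk.inj h1).2
    exact ⟨restrictedCotangentVector ι x v p pdot,
      tulczyjew_injective
        ((tulczyjew_tangentMap_restrictedCotangentInclusion ι x v p pdot).trans h1.symm),
      ⟨x, v⟩, (congrArg (fun w : CotangentSpace 𝓘(ℝ, F).tangent (TangentBundle 𝓘(ℝ, F) N) ⟨x, v⟩ =>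
        (⟨⟨x, v⟩, w⟩ : CotangentBundle 𝓘(ℝ, F).tangent (TangentBundle 𝓘(ℝ, F) N))) h2.symm).trans
        (tulczyjew_tangentMap_restrictCovector ι x v p pdot).symm⟩
  · rintro ⟨⟨⟨x, p⟩, ⟨v, pdot⟩⟩, rfl, w, hw⟩
    have hN := hw.trans (tulczyjew_tangentMap_restrictCovector ι x v p pdot)
    obtain ⟨rfl, h⟩ := TotalSpace.mk.inj hN
    exact ⟨⟨x, v⟩, tulczyjewCovector p pdot,
      tulczyjew_tangentMap_restrictedCotangentInclusion ι x v p pdot, (eq_of_heq h).symm⟩
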